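/- Let $\Omega\subset\mathbb R^d$, $d\in\{2,3\}$, be a bounded open set, let $\mathcal Q$ be the space of symmetric traceless real $3\times3$ matrices with $A\cdot B=A_{ij}B_{ij}$, and let $\mathcal Q_{\rm phys}\subset\mathcal Q$ be the set of those $A$ whose eigenvalues all lie in $(-\frac13,\frac23)$. Let $c_{02}>0$, $c_{21}>0$, $c_{21}+c_{22}>0$ and put $$E[A]=\int_\Omega q(A)-\tfrac12c_{02}|A|^2+\tfrac12\big(c_{21}|\nabla A|^2+c_{22}\,\partial_iA_{ik}\partial_jA_{jk}\big)\,d\mathbf r,\qquad q(A)=-\ln\det(A+\tfrac13I)-2\ln\det(\tfrac13I-\tfrac12A),$$ where $q=+\infty$ outside $\mathcal Q_{\rm phys}$. Fix $Q_{\rm bnd}\in H^1(\Omega;\mathcal Q)$ and impose the Dirichlet condition $A-Q_{\rm bnd}\in H^1_0(\Omega;\mathcal Q)$. Let $\partial G(A)\subset L^2(\Omega;\mathcal Q)$ be the subdifferential, under this Dirichlet condition, of the part $G[A]=E[A]+\frac12c_{02}\|A\|^2$ of the energy ($\|\cdot\|$ is the $L^2(\Omega)$ norm); that is, $\psi\in\partial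 G(A)$ if $G[A]<\infty$ and $G[B]-G[A]\ge(\psi,B-A)$ for all admissible $B$ with $G[B]<\infty$. Formally, $\partial G(A)$ consists of the field $\mathscr P\big(\frac{\partial q}{\partial A}\big)_{ij}-c_{21}\Delta A_{ij}-\frac{c_{22}}2\big(\partial_{ik}A_{kj}+\partial_{jk}A_{ki}-\frac23\partial_{kl}A_{kl}\delta_{ij}\big)$, where $\mathscr P$ is the orthogonal projection onto $\mathcal Q$. Let $Q:[0,T]\to L^2(\Omega;\mathcal Q)$ be a solution of the gradient flow $-\partial_tQ+c_{02}Q\in\partial G(Q)$ for a.e. $t\in(0,T)$, with $\partial_{tt}Q,\partial_{ttt}Q\in L^2(0,T;L^2(\Omega))$. Let $\delta t>0$, $t^n=n\,\delta t$, $t^N\le T$, let $Q^0,Q^1\in L^2(\Omega;\mathcal Q)$ be starting values, and let $Q^2,\dots,Q^N$ be given by the BDF2 scheme: for $1\le n<N$, $$-\frac{3Q^{n+1}-4Q^n+Q^{n-1}}{2\delta t}+c_{02}(2Q^n-Q^{n-1})\in\partial G(Q^{n+1}).$$ Write $R^n=Q^n-Q(t^n)$. There is an absolute constant $K>0$ such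 that, with $C=K(1+c_{02})$, if $C\delta t<1$ then for all $1\le n\le N$ $$\|R^n\|^2+\|2R^n-R^{n-1}\|^2\le C\exp\!\Big(\frac{C\,t^n}{1-C\delta t}\Big)\Big(\|R^0\|^2+\|R^1\|^2+\delta t^4\int_0^{t^n}\big(\|\partial_{tt}Q\|^2+\|\partial_{ttt}Q\|^2\big)\,dt\Big).$$ In particular, for exact starting values ($R^0=R^1=0$) the error is bounded by $C\exp\big(\frac{C t^n}{1-C\delta t}\big)\,\delta t^4\int_0^{t^n}(\|\partial_{tt}Q\|^2+\|\partial_{ttt}Q\|^2)\,dt$, so the scheme is of second order in time. -/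

import Mathlib

open MeasureTheory Set Filter Topology
open scoped ContDiff ENNReal

noncomputable section

namespace QTensor

/-- The space of symmetric traceless real `3 × 3` tensors, with the inner product
`A · B = ∑ i j, A i j * B i j` and the norm `|A|² = A · A`. The entry `A i j` is the coordinate
of index `(i, j)`. -/
def symTraceless : Submodule ℝ (EuclideanSpace ℝ (Fin 3 × Fin 3)) where
  carrier := {A | (∀ i j, A (i, j) = A (j, i)) ∧ ∑ i, A (i, i) = 0}
  add_mem' := by
    rintro A B ⟨hA, hA'⟩ ⟨hB, hB'⟩
    refine ⟨fun i j => ?_, ?_⟩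
    · simp [hA i j, hB i j]
    · simp [Finset.sum_add_distrib, hA', hB']
  zero_mem' := by simp
  smul_mem' := by
    rintro c A ⟨hA, hA'⟩
    refine ⟨fun i j => ?_, ?_⟩
    · simp [hA i j]
    · simp [← Finset.mul_sum, hA']

/-- The space of `Q`-tensors. -/
abbrev QT : Type := symTraceless

/-- The entry `A i j`. -/
def entry (A : QT) (i j : Fin 3) : ℝ := (A : EuclideanSpace ℝ (Fin 3 × Fin 3)) (i, j)

/-- A `Q`-tensor as a `3 × 3` matrix. -/
def toMat (A : QT) : Matrix (Fin 3) (Fin 3) ℝ := Matrix.of (entry A)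

/-- The physical `Q`-tensors: all eigenvalues lie in `(-1/3, 2/3)`. -/
def phys : Set QT := {A | ∀ l ∈ spectrum ℝ (toMat A), -(1 / 3 : ℝ) < l ∧ l < 2 / 3}

/-- The quasi-entropy `q(A) = - ln det (A + I/3) - 2 ln det (I/3 - A/2)`. It is only ever
evaluated on `phys`; outside `phys` its value is `+∞` by convention, which is encoded by the
requirement of being a.e. in `phys` in `FiniteEnergy` below. -/
def quasiEntropy (A : QT) : ℝ :=
  -Real.log (toMat A + (1 / 3 : ℝ) • (1 : Matrix (Fin 3) (Fin 3) ℝ)).det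
    - 2 * Real.log ((1 / 3 : ℝ) • (1 : Matrix (Fin 3) (Fin 3) ℝ) - (1 / 2 : ℝ) • toMat A).det

/-- Physical space `ℝ^d`. -/
abbrev Sp (d : ℕ) : Type := EuclideanSpace ℝ (Fin d)

/-- The Hilbert space `L²(Ω; 𝒬)` of square integrable `Q`-tensor fields on `Ω`, with
`(A, B) = ∫_Ω A · B`. -/
abbrev L2Q {d : ℕ} (Ω : Set (Sp d)) : Type := Lp QT 2 ((volume : Measure (Sp d)).restrict Ω)

/-- The `k`-th classical partial derivative. -/
def pderiv {d : ℕ} {F : Type*} [NormedAddCommGroup F] [NormedSpace ℝ F]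
    (k : Fin d) (φ : Sp d → F) (x : Sp d) : F :=
  fderiv ℝ φ x (EuclideanSpace.single k 1)

/-- `φ ∈ C_c^∞(Ω; F)`. -/
def IsTest {d : ℕ} {F : Type*} [NormedAddCommGroup F] [NormedSpace ℝ F]
    (Ω : Set (Sp d)) (φ : Sp d → F) : Prop :=
  ContDiff ℝ ∞ φ ∧ HasCompactSupport φ ∧ tsupport φ ⊆ Ω

/-- `G k ∈ L²(Ω; 𝒬)` is the weak partial derivative `∂_k A` for every `k`. -/
def IsWeakGrad {d : ℕ} {Ω : Set (Sp d)} (A : L2Q Ω) (G : Fin d → L2Q Ω) : Prop :=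
  ∀ (k : Fin d) (φ : Sp d → ℝ), IsTest Ω φ →
    ∫ x in Ω, pderiv k φ x • A x = -∫ x in Ω, φ x • G k x

/-- `A ∈ H¹(Ω; 𝒬)`. -/
def MemH1 {d : ℕ} {Ω : Set (Sp d)} (A : L2Q Ω) : Prop := ∃ G, IsWeakGrad A G

open Classical in
/-- The weak gradient of `A` (zero, by convention, if `A` is not in `H¹`). -/
def weakGrad {d : ℕ} {Ω : Set (Sp d)} (A : L2Q Ω) : Fin d → L2Q Ω :=
  if h : MemH1 A then h.choose else 0

/-- `A ∈ H¹₀(Ω; 𝒬)`, the closure of `C_c^∞(Ω; 𝒬)` in the norm of `H¹`. -/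
def MemH10 {d : ℕ} {Ω : Set (Sp d)} (A : L2Q Ω) : Prop :=
  ∃ (G : Fin d → L2Q Ω) (φ : ℕ → Sp d → QT), (∀ m, IsTest Ω (φ m)) ∧
    Tendsto (fun m => eLpNorm (fun x => φ m x - A x) 2 (volume.restrict Ω)) atTop (𝓝 0) ∧
    ∀ k, Tendsto (fun m => eLpNorm (fun x => pderiv k (φ m) x - G k x) 2 (volume.restrict Ω))
      atTop (𝓝 0)

/-- The elastic energy density `½ (c₂₁ |∇A|² + c₂₂ ∂_i A_{ik} ∂_j A_{jk})` as a function of the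
gradient `G i = ∂_i A` at a point. The derivative indices run over the `d ≤ 3` spatial directions
and the tensor indices over `1, 2, 3`. -/
def elasticDensity {d : ℕ} (hd : d ≤ 3) (c₂₁ c₂₂ : ℝ) (G : Fin d → QT) : ℝ :=
  (1 / 2) * (c₂₁ * ∑ i, ‖G i‖ ^ 2
    + c₂₂ * ∑ k : Fin 3, (∑ i : Fin d, entry (G i) (Fin.castLE hd i) k) ^ 2)

/-- `∫_Ω f_e(A)`. -/
def elasticEnergy {d : ℕ} {Ω : Set (Sp d)} (hd : d ≤ 3) (c₂₁ c₂₂ : ℝ) (A : L2Q Ω) : ℝ :=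
  ∫ x in Ω, elasticDensity hd c₂₁ c₂₂ (fun i => weakGrad A i x)

/-- `A` lies in `H¹(Ω; 𝒬)`, satisfies the Dirichlet condition `A = Qbnd` on `∂Ω` (where `Qbnd` is
given by an `H¹` field, and equality on the boundary means that the difference lies in `H¹₀`),
and has finite energy: `A` is a.e. physical and `q(A)` is integrable. -/
def FiniteEnergy {d : ℕ} {Ω : Set (Sp d)} (Qbnd A : L2Q Ω) : Prop :=
  MemH1 A ∧ MemH10 (A - Qbnd) ∧ (∀ᵐ x ∂(volume.restrict Ω), A x ∈ phys) ∧
    Integrable (fun x => quasiEntropy (A x)) (volume.restrict Ω)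

/-- The convex part `∫_Ω q(A) + f_e(A)` of the free energy
`E[A] = ∫_Ω q(A) - ½ c₀₂ |A|² + f_e(A)`, on fields of finite energy (it is `+∞` on others). -/
def convexEnergy {d : ℕ} {Ω : Set (Sp d)} (hd : d ≤ 3) (c₂₁ c₂₂ : ℝ) (A : L2Q Ω) : ℝ :=
  (∫ x in Ω, quasiEntropy (A x)) + elasticEnergy hd c₂₁ c₂₂ A

/-- The subdifferential at `A`, in `L²(Ω; 𝒬)`, of the convex part of the free energy under the
Dirichlet condition. This is the rigorous meaning of
`𝒫(∂q/∂A)_{ij} - c₂₁ ΔA_{ij} - ½ c₂₂ (∂_{ik}A_{jk} + ∂_{jk}A_{ik} - ⅔ ∂_{kl}A_{kl} δ_{ij})`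
for the singular potential `q`. It is empty unless `A` has finite energy. -/
def subdiff {d : ℕ} {Ω : Set (Sp d)} (hd : d ≤ 3) (c₂₁ c₂₂ : ℝ) (Qbnd A : L2Q Ω) :
    Set (L2Q Ω) :=
  {ψ | FiniteEnergy Qbnd A ∧ ∀ B : L2Q Ω, FiniteEnergy Qbnd B →
    inner ℝ ψ (B - A) ≤ convexEnergy hd c₂₁ c₂₂ B - convexEnergy hd c₂₁ c₂₂ A}

/-- The variational derivative `δE/δA`: the subdifferential of the convex part of `E` minus the
derivative `c₀₂ A` of the smooth concave part. -/
def varDeriv {d : ℕ} {Ω : Set (Sp d)} (hd : d ≤ 3) (c₀₂ c₂₁ c₂₂ : ℝ) (Qbnd A : L2Q Ω) :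
    Set (L2Q Ω) :=
  {ξ | ξ + c₀₂ • A ∈ subdiff hd c₂₁ c₂₂ Qbnd A}

/-- `v ∈ L¹(0,T; X)` is the time derivative of the absolutely continuous curve `u : [0,T] → X`,
i.e. `u ∈ W^{1,1}(0,T; X)` with `∂_t u = v`, `u` being the continuous representative. -/
def IsTimeDeriv {X : Type*} [NormedAddCommGroup X] [NormedSpace ℝ X] (T : ℝ) (u v : ℝ → X) :
    Prop :=
  IntervalIntegrable v volume 0 T ∧ ∀ t ∈ Icc (0 : ℝ) T, u t = u 0 + ∫ s in (0 : ℝ)..t, v s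

/-- The gradient flow `∂_t Q = - δE/δQ` with `Q = Qbnd` on `∂Ω`, for a.e. `t ∈ (0,T)`, where
`Qt = ∂_t Q`. -/
def IsGradientFlow {d : ℕ} {Ω : Set (Sp d)} (hd : d ≤ 3) (c₀₂ c₂₁ c₂₂ : ℝ) (Qbnd : L2Q Ω)
    (T : ℝ) (Q Qt : ℝ → L2Q Ω) : Prop :=
  IsTimeDeriv T Q Qt ∧
    ∀ᵐ t ∂(volume.restrict (Ioo (0 : ℝ) T)), -Qt t ∈ varDeriv hd c₀₂ c₂₁ c₂₂ Qbnd (Q t)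

/-- One step of the second-order scheme, which computes `A₂ = Q^{n+1}` from `A₁ = Q^n` and
`A₀ = Q^{n-1}`:
`(3 Q^{n+1} - 4 Q^n + Q^{n-1}) / (2 δt) = - D + c₀₂ (2 Q^n - Q^{n-1})` with `D` in the
subdifferential of the convex part of the energy at `Q^{n+1}`, and `Q^{n+1} = Qbnd` on `∂Ω`. -/
def IsBDF2Step {d : ℕ} {Ω : Set (Sp d)} (hd : d ≤ 3) (c₀₂ c₂₁ c₂₂ : ℝ) (Qbnd : L2Q Ω)
    (δt : ℝ) (A₀ A₁ A₂ : L2Q Ω) : Prop :=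
  ∃ D ∈ subdiff hd c₂₁ c₂₂ Qbnd A₂,
    (1 / (2 * δt)) • ((3 : ℝ) • A₂ - (4 : ℝ) • A₁ + A₀) = -D + c₀₂ • ((2 : ℝ) • A₁ - A₀)

end QTensor

end

namespace QTensor

open scoped RealInnerProductSpace

/-! The energy enters only through monotonicity of its subdifferential, so the estimate is one about
Hilbert spaces. Subtracting the flow at `t^(n+1)` from the scheme gives a BDF2 recursion for `R`,
with a consistency error from the backward difference and one from the extrapolation. Pairing it
with `R (n + 1)` gives the nonlinear part a favourable sign (`subgradient_monotone`), while
`bdf2_identity` turns the difference quotient into an increment of `‖R n‖² + ‖2 R n - R (n - 1)‖²`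
plus a square. Taylor expansion and Cauchy–Schwarz bound the squared consistency errors by `δt ^ 3`
times integrals over two steps, and `discrete_gronwall` sums the steps.

The flow inclusion holds only for a.e. time. With the scheme's pair fixed, however, the monotonicity
inequality is continuous in time, hence valid at every grid point (`inner_nonneg_of_ae`). -/

theorem sq_integral_norm_le {X : Type*} [NormedAddCommGroup X] {f : ℝ → X} {a b : ℝ} (hab : a < b)
    (hf : IntervalIntegrable f volume a b)
    (hf2 : IntervalIntegrable (fun t => ‖f t‖ ^ 2) volume a b) :
    (∫ t in a..b, ‖f t‖) ^ 2 ≤ (b - a) * ∫ t in a..b, ‖f t‖ ^ 2 := by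
  have hba : 0 < b - a := sub_pos.2 hab
  set W := ∫ t in a..b, ‖f t‖ with hW
  set m := W / (b - a) with hm
  -- Cauchy–Schwarz as nonnegativity of the variance: `m` is the mean of `‖f‖`.
  have h0 : 0 ≤ ∫ t in a..b, ((‖f t‖ ^ 2 - (2 * m) * ‖f t‖) + m ^ 2) :=
    intervalIntegral.integral_nonneg hab.le fun t _ => by nlinarith [sq_nonneg (‖f t‖ - m)]
  rw [intervalIntegral.integral_add (hf2.sub (hf.norm.const_mul _)) (by simp),
    intervalIntegral.integral_sub hf2 (hf.norm.const_mul _),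
    intervalIntegral.integral_const_mul, intervalIntegral.integral_const, ← hW, smul_eq_mul] at h0
  have hWm : W = m * (b - a) := by rw [hm]; field_simp
  nlinarith

/-! ### Taylor expansion and consistency errors -/

section TimeDeriv

variable {X : Type*} [NormedAddCommGroup X] [NormedSpace ℝ X] {T : ℝ} {u v w z : ℝ → X}

theorem IsTimeDeriv.intervalIntegrable (hu : IsTimeDeriv T u v) {a b : ℝ} (ha : a ∈ Icc 0 T)
    (hb : b ∈ Icc 0 T) : IntervalIntegrable v volume a b := by
  refine hu.1.mono_set ?_
  rw [uIcc_of_le (ha.1.trans ha.2)]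
  exact uIcc_subset_Icc ha hb

theorem IsTimeDeriv.sub_eq (hu : IsTimeDeriv T u v) {a b : ℝ} (ha : a ∈ Icc 0 T)
    (hb : b ∈ Icc 0 T) : u b - u a = ∫ t in a..b, v t := by
  have h0 : (0 : ℝ) ∈ Icc 0 T := ⟨le_rfl, ha.1.trans ha.2⟩
  rw [hu.2 a ha, hu.2 b hb, add_sub_add_left_eq_sub]
  exact intervalIntegral.integral_interval_sub_left (hu.intervalIntegrable h0 hb)
    (hu.intervalIntegrable h0 ha)

theorem IsTimeDeriv.continuousOn (hT : 0 ≤ T) (hu : IsTimeDeriv T u v) :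
    ContinuousOn u (Icc 0 T) := by
  have h := intervalIntegral.continuousOn_primitive_interval
    (intervalIntegrable_iff_integrableOn_Icc_of_le hT |>.1 hu.1 |> fun h => by
      rwa [← uIcc_of_le hT] at h)
  rw [uIcc_of_le hT] at h
  exact (continuousOn_const.add h).congr hu.2

/-- A curve stays close to the primitive `P` of any approximation `p` of its derivative. -/
theorem IsTimeDeriv.norm_sub_le [CompleteSpace X] (hu : IsTimeDeriv T u v) {P p : ℝ → X}
    (hP : ∀ t, HasDerivAt P (p t) t) (hp : Continuous p) {a b M : ℝ} (ha : 0 ≤ a) (hab : a ≤ b)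
    (hb : b ≤ T) (hM : ∀ t ∈ Icc a b, ‖v t - p t‖ ≤ M) :
    ‖(u b - u a) - (P b - P a)‖ ≤ M * (b - a) := by
  have ha' : a ∈ Icc 0 T := ⟨ha, hab.trans hb⟩
  have hb' : b ∈ Icc 0 T := ⟨ha.trans hab, hb⟩
  rw [hu.sub_eq ha' hb', ← intervalIntegral.integral_eq_sub_of_hasDerivAt (fun t _ => hP t)
    (hp.intervalIntegrable a b),
    ← intervalIntegral.integral_sub (hu.intervalIntegrable ha' hb') (hp.intervalIntegrable a b)]
  refine (intervalIntegral.norm_integral_le_of_norm_le_const fun t ht => hM t ?_).trans_eq ?_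
  · rw [uIoc_of_le hab] at ht
    exact Ioc_subset_Icc_self ht
  · rw [abs_of_nonneg (sub_nonneg.2 hab)]

theorem IsTimeDeriv.norm_sub_le_integral (hu : IsTimeDeriv T u v) {a b t : ℝ} (ha : 0 ≤ a)
    (hb : b ≤ T) (ht : t ∈ Icc a b) : ‖u t - u b‖ ≤ ∫ r in a..b, ‖v r‖ := by
  have hab := ht.1.trans ht.2
  have ht' : t ∈ Icc 0 T := ⟨ha.trans ht.1, ht.2.trans hb⟩
  have ha' : a ∈ Icc 0 T := ⟨ha, hab.trans hb⟩
  have hb' : b ∈ Icc 0 T := ⟨ha.trans hab, hb⟩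
  rw [norm_sub_rev, hu.sub_eq ht' hb']
  refine (intervalIntegral.norm_integral_le_integral_norm ht.2).trans ?_
  exact intervalIntegral.integral_mono_interval ht.1 ht.2 le_rfl
    (Eventually.of_forall fun _ => norm_nonneg _) (hu.intervalIntegrable ha' hb').norm

/-- The expansion is about the right end `b`, the implicit time level. Integrating over all of `[a,
b]` gives every node the same remainder factor. -/
theorem IsTimeDeriv.norm_taylor_one_le [CompleteSpace X] (hu : IsTimeDeriv T u v) (hv : IsTimeDeriv T v w)
    {a b t : ℝ} (ha : 0 ≤ a) (hb : b ≤ T) (ht : t ∈ Icc a b) :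
    ‖u t - u b - (t - b) • v b‖ ≤ (∫ r in a..b, ‖w r‖) * (b - t) := by
  have h := hu.norm_sub_le (P := fun r => r • v b) (p := fun _ => v b)
    (fun r => by simpa using (hasDerivAt_id r).smul_const (v b)) continuous_const
    (ha.trans ht.1) ht.2 hb
    (fun r hr => hv.norm_sub_le_integral ha hb ⟨ht.1.trans hr.1, hr.2⟩)
  rw [← norm_neg] at h
  refine le_of_eq_of_le (congrArg _ ?_) h
  module

theorem IsTimeDeriv.norm_taylor_two_le [CompleteSpace X] (hu : IsTimeDeriv T u v) (hv : IsTimeDeriv T v w)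
    (hw : IsTimeDeriv T w z) {a b t : ℝ} (ha : 0 ≤ a) (hb : b ≤ T) (ht : t ∈ Icc a b) :
    ‖u t - u b - (t - b) • v b - ((t - b) ^ 2 / 2) • w b‖ ≤
      (∫ r in a..b, ‖z r‖) * (b - a) * (b - t) := by
  have hZ : 0 ≤ ∫ r in a..b, ‖z r‖ :=
    intervalIntegral.integral_nonneg (ht.1.trans ht.2) fun _ _ => norm_nonneg _
  have h := hu.norm_sub_le (P := fun r => r • v b + ((r - b) ^ 2 / 2) • w b)
    (p := fun r => v b + (r - b) • w b) (M := (∫ r in a..b, ‖z r‖) * (b - a))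
    (fun r => by
      have h1 : HasDerivAt (fun r : ℝ => (r - b) ^ 2 / 2) (r - b) r := by
        have h2 := (((hasDerivAt_id r).sub_const b).pow 2).div_const 2
        simpa using h2
      have h3 := ((hasDerivAt_id r).smul_const (v b)).add (h1.smul_const (w b))
      rw [one_smul] at h3
      exact h3)
    (by fun_prop) (ha.trans ht.1) ht.2 hb
    (fun r hr => by
      have hr' : r ∈ Icc a b := ⟨ht.1.trans hr.1, hr.2⟩
      rw [← sub_sub]
      refine (hv.norm_taylor_one_le hw ha hb hr').trans ?_
      exact mul_le_mul_of_nonneg_left (by linarith [hr'.1]) hZ)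
  rw [← norm_neg] at h
  refine le_of_eq_of_le (congrArg _ ?_) h
  module

/-- The consistency error of the second-order extrapolation. -/
theorem IsTimeDeriv.norm_extrapolation_sq_le [CompleteSpace X] (hu : IsTimeDeriv T u v) (hv : IsTimeDeriv T v w)
    {a h : ℝ} (ha : 0 ≤ a) (hh : 0 < h) (hb : a + 2 * h ≤ T)
    (hw2 : IntervalIntegrable (fun t => ‖w t‖ ^ 2) volume a (a + 2 * h)) :
    ‖(2 : ℝ) • u (a + h) - u a - u (a + 2 * h)‖ ^ 2 ≤
      32 * h ^ 3 * ∫ t in a..(a + 2 * h), ‖w t‖ ^ 2 := by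
  have hCS := sq_integral_norm_le (by linarith : a < a + 2 * h)
    (hv.intervalIntegrable ⟨ha, by linarith⟩ ⟨by linarith, hb⟩) hw2
  have h1 := hu.norm_taylor_one_le hv ha hb (t := a + h) ⟨by linarith, by linarith⟩
  have h2 := hu.norm_taylor_one_le hv ha hb (t := a) ⟨by linarith, by linarith⟩
  set W := ∫ t in a..(a + 2 * h), ‖w t‖
  have key : ‖(2 : ℝ) • u (a + h) - u a - u (a + 2 * h)‖ ≤ 4 * h * W := by
    -- Constant and linear Taylor terms cancel; the remainders add up to `2 * (h * W) + 2 * h * W`.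
    have e : (2 : ℝ) • u (a + h) - u a - u (a + 2 * h) =
        (2 : ℝ) • (u (a + h) - u (a + 2 * h) - (a + h - (a + 2 * h)) • v (a + 2 * h)) -
          (u a - u (a + 2 * h) - (a - (a + 2 * h)) • v (a + 2 * h)) := by module
    rw [e]
    refine (_root_.norm_sub_le _ _).trans ?_
    rw [norm_smul, Real.norm_ofNat]
    linarith
  calc _ ≤ (4 * h * W) ^ 2 := pow_le_pow_left₀ (norm_nonneg _) key 2
    _ = 16 * h ^ 2 * W ^ 2 := by ring
    _ ≤ 16 * h ^ 2 * ((a + 2 * h - a) * ∫ t in a..(a + 2 * h), ‖w t‖ ^ 2) := by gcongr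
    _ = _ := by ring

/-- The consistency error of the second-order backward difference. -/
theorem IsTimeDeriv.norm_backward_diff_sq_le [CompleteSpace X] (hu : IsTimeDeriv T u v) (hv : IsTimeDeriv T v w)
    (hw : IsTimeDeriv T w z) {a h : ℝ} (ha : 0 ≤ a) (hh : 0 < h) (hb : a + 2 * h ≤ T)
    (hz2 : IntervalIntegrable (fun t => ‖z t‖ ^ 2) volume a (a + 2 * h)) :
    ‖v (a + 2 * h) - (1 / (2 * h)) • ((3 : ℝ) • u (a + 2 * h) - (4 : ℝ) • u (a + h) + u a)‖ ^ 2 ≤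
      72 * h ^ 3 * ∫ t in a..(a + 2 * h), ‖z t‖ ^ 2 := by
  have hCS := sq_integral_norm_le (by linarith : a < a + 2 * h)
    (hw.intervalIntegrable ⟨ha, by linarith⟩ ⟨by linarith, hb⟩) hz2
  have h1 := hu.norm_taylor_two_le hv hw ha hb (t := a + h) ⟨by linarith, by linarith⟩
  have h2 := hu.norm_taylor_two_le hv hw ha hb (t := a) ⟨by linarith, by linarith⟩
  set W := ∫ t in a..(a + 2 * h), ‖z t‖
  have key : ‖v (a + 2 * h) - (1 / (2 * h)) •
      ((3 : ℝ) • u (a + 2 * h) - (4 : ℝ) • u (a + h) + u a)‖ ≤ 6 * h * W := by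
    -- The quadratic terms cancel too, and the linear ones leave exactly `v`. The remainders total
    -- `12 * h ^ 2 * W`, divided by `2 * h`.
    have e : v (a + 2 * h) - (1 / (2 * h)) •
        ((3 : ℝ) • u (a + 2 * h) - (4 : ℝ) • u (a + h) + u a) =
        (1 / (2 * h)) • ((4 : ℝ) • (u (a + h) - u (a + 2 * h) -
          (a + h - (a + 2 * h)) • v (a + 2 * h) -
          ((a + h - (a + 2 * h)) ^ 2 / 2) • w (a + 2 * h)) -
          (u a - u (a + 2 * h) - (a - (a + 2 * h)) • v (a + 2 * h) -
          ((a - (a + 2 * h)) ^ 2 / 2) • w (a + 2 * h))) := by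
      match_scalars <;> field_simp <;> ring
    rw [e, norm_smul, Real.norm_of_nonneg (by positivity), one_div, inv_mul_le_iff₀ (by positivity)]
    refine (_root_.norm_sub_le _ _).trans ?_
    rw [norm_smul, Real.norm_ofNat]
    linarith
  calc _ ≤ (6 * h * W) ^ 2 := pow_le_pow_left₀ (norm_nonneg _) key 2
    _ = 36 * h ^ 2 * W ^ 2 := by ring
    _ ≤ 36 * h ^ 2 * ((a + 2 * h - a) * ∫ t in a..(a + 2 * h), ‖z t‖ ^ 2) := by gcongr
    _ = _ := by ring

end TimeDeriv

/-- A continuous function that agrees a.e. with its positive part agrees with it everywhere. -/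
theorem nonneg_of_ae_nonneg {f : ℝ → ℝ} {T : ℝ} (hT : 0 < T) (hf : ContinuousOn f (Icc 0 T))
    (h : ∀ᵐ t ∂(volume.restrict (Ioo (0 : ℝ) T)), 0 ≤ f t) : ∀ t ∈ Icc 0 T, 0 ≤ f t := by
  rw [Measure.restrict_congr_set Ioo_ae_eq_Icc] at h
  have he : f =ᵐ[volume.restrict (Icc 0 T)] fun t => max (f t) 0 := by
    filter_upwards [h] with t ht
    exact (max_eq_left ht).symm
  intro t ht
  have hmax : ContinuousOn (fun t => max (f t) 0) (Icc 0 T) := hf.sup continuousOn_const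
  rw [Measure.eqOn_Icc_of_ae_eq volume hT.ne he hf hmax ht]
  exact le_max_right _ _

/-! ### Energy stability of BDF2 and Gronwall -/

section Stability

variable {X : Type*} [NormedAddCommGroup X] [InnerProductSpace ℝ X]

/-- The `G`-stability identity of the BDF2 method. -/
theorem bdf2_identity (x y z : X) :
    2 * ⟪(3 : ℝ) • z - (4 : ℝ) • y + x, z⟫ =
      (‖z‖ ^ 2 + ‖(2 : ℝ) • z - y‖ ^ 2) - (‖y‖ ^ 2 + ‖(2 : ℝ) • y - x‖ ^ 2)
        + ‖z - (2 : ℝ) • y + x‖ ^ 2 := by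
  simp only [← real_inner_self_eq_norm_sq, inner_add_left, inner_sub_left, inner_add_right,
    inner_sub_right, real_inner_smul_left, real_inner_smul_right, real_inner_comm x y,
    real_inner_comm x z, real_inner_comm y z]
  ring

theorem two_mul_inner_le (x y : X) : 2 * ⟪x, y⟫ ≤ ‖x‖ ^ 2 + ‖y‖ ^ 2 := by
  have h := norm_sub_sq_real x y
  nlinarith [sq_nonneg ‖x - y‖]

/-- Here `hpos` is monotonicity written in the errors, with `τ` and `σ` the consistency errors of
difference and extrapolation. Young's inequality splits each product with `z`. -/
theorem bdf2_step_le {h c : ℝ} (hh : 0 < h) (hc : 0 ≤ c) {x y z τ σ : X}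
    (hpos : 0 ≤ ⟪-((1 / (2 * h)) • ((3 : ℝ) • z - (4 : ℝ) • y + x)) + c • ((2 : ℝ) • y - x)
      + τ + c • σ, z⟫) :
    ‖z‖ ^ 2 + ‖(2 : ℝ) • z - y‖ ^ 2 ≤ ‖y‖ ^ 2 + ‖(2 : ℝ) • y - x‖ ^ 2 +
      2 * h * ((1 + 2 * c) * ‖z‖ ^ 2 + c * ‖(2 : ℝ) • y - x‖ ^ 2 + ‖τ‖ ^ 2 + c * ‖σ‖ ^ 2) := by
  rw [inner_add_left, inner_add_left, inner_add_left, inner_neg_left, real_inner_smul_left,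
    real_inner_smul_left, real_inner_smul_left] at hpos
  have hid := bdf2_identity x y z
  have h1 := mul_le_mul_of_nonneg_left (two_mul_inner_le ((2 : ℝ) • y - x) z) hc
  have h2 := two_mul_inner_le τ z
  have h3 := mul_le_mul_of_nonneg_left (two_mul_inner_le σ z) hc
  have h4 : 2 * ⟪(3 : ℝ) • z - (4 : ℝ) • y + x, z⟫ ≤
      2 * h * (c * (2 * ⟪(2 : ℝ) • y - x, z⟫) + 2 * ⟪τ, z⟫ + c * (2 * ⟪σ, z⟫)) := by
    have := mul_nonneg (by positivity : (0 : ℝ) ≤ 4 * h) hpos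
    have e : 4 * h * (1 / (2 * h) * ⟪(3 : ℝ) • z - (4 : ℝ) • y + x, z⟫) =
      2 * ⟪(3 : ℝ) • z - (4 : ℝ) • y + x, z⟫ := by field_simp; ring
    linarith
  have h5 : 2 * h * (c * (2 * ⟪(2 : ℝ) • y - x, z⟫) + 2 * ⟪τ, z⟫ + c * (2 * ⟪σ, z⟫)) ≤
      2 * h * ((1 + 2 * c) * ‖z‖ ^ 2 + c * ‖(2 : ℝ) • y - x‖ ^ 2 + ‖τ‖ ^ 2 + c * ‖σ‖ ^ 2) :=
    mul_le_mul_of_nonneg_left (by linarith) (by positivity)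
  linarith [sq_nonneg ‖z - (2 : ℝ) • y + x‖]

end Stability

/-- The amplification factor of an implicit step with relative growth `x` is at most
`exp (x / (1 - x))`. -/
theorem le_exp_mul_of_implicit_le {x a b E₁ E₂ g : ℝ} (hx : x < 1) (ha0 : 0 ≤ a) (ha : a ≤ x / 2)
    (hb : b ≤ x / 2) (hE : 0 ≤ E₁) (hg : 0 ≤ g) (h : (1 - a) * E₂ ≤ (1 + b) * E₁ + g) :
    E₂ ≤ Real.exp ((1 - x)⁻¹ * x) * E₁ + 2 * g := by
  have hx1 : 0 < 1 - x := by linarith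
  have hexp : (1 - x)⁻¹ ≤ Real.exp ((1 - x)⁻¹ * x) := by
    have h1 := Real.add_one_le_exp ((1 - x)⁻¹ * x)
    have h2 : (1 - x)⁻¹ * x + 1 = (1 - x)⁻¹ := by field_simp; ring
    linarith
  -- Because `(1 + x / 2) * (1 - x) ≤ 1 - x / 2`.
  have h1 : 1 + b ≤ (1 - a) * (1 - x)⁻¹ := by
    rw [← div_eq_mul_inv, le_div_iff₀ hx1]
    nlinarith
  have h2 : 1 + b ≤ (1 - a) * Real.exp ((1 - x)⁻¹ * x) :=
    h1.trans (mul_le_mul_of_nonneg_left hexp (by linarith))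
  have h3 := mul_le_mul_of_nonneg_right h2 hE
  -- Since `a ≤ 1 / 2`, dividing by `1 - a` at most doubles `g`.
  have h4 : g ≤ (1 - a) * (2 * g) := by nlinarith
  refine le_of_mul_le_mul_left ?_ (by linarith : 0 < 1 - a)
  linarith

/-- A discrete Gronwall inequality, with a source telescoping over two steps. -/
theorem discrete_gronwall {E I : ℕ → ℝ} {θ m : ℝ} (hθ : 0 ≤ θ) (hm : 0 ≤ m) {N : ℕ}
    (hI0 : I 0 = 0) (hI : ∀ n < N, I n ≤ I (n + 1))
    (h : ∀ n, n + 1 < N → E (n + 2) ≤ Real.exp θ * E (n + 1) + m * (I (n + 2) - I n)) (n : ℕ) (hn : n + 1 ≤ N) :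
    E (n + 1) ≤ Real.exp (n * θ) * (E 1 + m * (I (n + 1) + I n)) := by
  induction n with
  | zero =>
    have := hI 0 (by omega)
    have : 0 ≤ m * (I 1 + I 0) := mul_nonneg hm (by linarith)
    simpa using this
  | succ n ih =>
    have hexp : 1 ≤ Real.exp ((n + 1 : ℕ) * θ) := Real.one_le_exp (by positivity)
    have hs : 0 ≤ m * (I (n + 2) - I n) :=
      mul_nonneg hm (by linarith [hI n (by omega), hI (n + 1) (by omega)])
    -- The source is the increment of `I (n + 1) + I n`, which explains that sum in the bound.
    calc E (n + 2) ≤ Real.exp θ * E (n + 1) + m * (I (n + 2) - I n) := h n (by omega)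
      _ ≤ Real.exp θ * (Real.exp (n * θ) * (E 1 + m * (I (n + 1) + I n))) +
          Real.exp ((n + 1 : ℕ) * θ) * (m * (I (n + 2) - I n)) :=
        add_le_add (mul_le_mul_of_nonneg_left (ih (by omega)) (Real.exp_pos _).le)
          (le_mul_of_one_le_left hs hexp)
      _ = _ := by
        have : Real.exp ((n + 1 : ℕ) * θ) = Real.exp θ * Real.exp (n * θ) := by
          rw [← Real.exp_add]; push_cast; ring_nf
        rw [this]; ring

/-! ### Error estimate for the abstract gradient flow -/

section Flow

variable {X : Type*} [NormedAddCommGroup X] [InnerProductSpace ℝ X]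

theorem subgradient_monotone {f : X → ℝ} {A B ψ χ : X} (hA : ⟪ψ, B - A⟫ ≤ f B - f A)
    (hB : ⟪χ, A - B⟫ ≤ f A - f B) : 0 ≤ ⟪ψ - χ, A - B⟫ := by
  rw [← neg_sub A B, inner_neg_right] at hA
  rw [inner_sub_left]
  linarith

/-- Monotonicity against a fixed pair passes from almost every time to every time. -/
theorem inner_nonneg_of_ae {c T : ℝ} {Q Qt Qtt : ℝ → X} (hT : 0 < T) (hQ : IsTimeDeriv T Q Qt)
    (hQt : IsTimeDeriv T Qt Qtt) {A D : X}
    (h : ∀ᵐ t ∂(volume.restrict (Ioo (0 : ℝ) T)), 0 ≤ ⟪-Qt t + c • Q t - D, Q t - A⟫) {t : ℝ}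
    (ht : t ∈ Icc 0 T) : 0 ≤ ⟪-Qt t + c • Q t - D, Q t - A⟫ := by
  have c1 := hQ.continuousOn hT.le
  have c2 := hQt.continuousOn hT.le
  refine nonneg_of_ae_nonneg (f := fun t => ⟪-Qt t + c • Q t - D, Q t - A⟫) hT ?_ h t ht
  exact ((c2.neg.add (c1.const_smul c)).sub continuousOn_const).inner (c1.sub continuousOn_const)

/-- One step of the error estimate for the BDF2 scheme. -/
theorem bdf2_error_step [CompleteSpace X] {c₀₂ T : ℝ} {Q Qt Qtt Qttt : ℝ → X}
    (hc : 0 ≤ c₀₂) (hQ : IsTimeDeriv T Q Qt) (hQt : IsTimeDeriv T Qt Qtt)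
    (hQtt : IsTimeDeriv T Qtt Qttt) {a h : ℝ} (ha : 0 ≤ a) (hh : 0 < h) (hb : a + 2 * h ≤ T)
    (hi2 : IntervalIntegrable (fun t => ‖Qtt t‖ ^ 2) volume a (a + 2 * h))
    (hi3 : IntervalIntegrable (fun t => ‖Qttt t‖ ^ 2) volume a (a + 2 * h))
    {A₀ A₁ A₂ D : X} (hmono : 0 ≤ ⟪-Qt (a + 2 * h) + c₀₂ • Q (a + 2 * h) - D, Q (a + 2 * h) - A₂⟫)
    (hD : (1 / (2 * h)) • ((3 : ℝ) • A₂ - (4 : ℝ) • A₁ + A₀) = -D + c₀₂ • ((2 : ℝ) • A₁ - A₀))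
    {x y z : X} (hx : x = A₀ - Q a) (hy : y = A₁ - Q (a + h)) (hz : z = A₂ - Q (a + 2 * h))
    (hsmall : 600 * (1 + c₀₂) * h < 1) :
    ‖z‖ ^ 2 + ‖(2 : ℝ) • z - y‖ ^ 2 ≤
      Real.exp ((1 - 600 * (1 + c₀₂) * h)⁻¹ * (600 * (1 + c₀₂) * h)) *
        (‖y‖ ^ 2 + ‖(2 : ℝ) • y - x‖ ^ 2) +
      288 * (1 + c₀₂) * h ^ 4 * ∫ t in a..(a + 2 * h), (‖Qtt t‖ ^ 2 + ‖Qttt t‖ ^ 2) := by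
  have hD' : D = c₀₂ • ((2 : ℝ) • A₁ - A₀) -
      (1 / (2 * h)) • ((3 : ℝ) • A₂ - (4 : ℝ) • A₁ + A₀) := by
    rw [hD]; abel
  have e2 := hQ.norm_extrapolation_sq_le hQt ha hh hb hi2
  have e1 := hQ.norm_backward_diff_sq_le hQt hQtt ha hh hb hi3
  set σ := (2 : ℝ) • Q (a + h) - Q a - Q (a + 2 * h) with hσ
  set τ := Qt (a + 2 * h) - (1 / (2 * h)) •
    ((3 : ℝ) • Q (a + 2 * h) - (4 : ℝ) • Q (a + h) + Q a) with hτ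
  have hpos : 0 ≤ ⟪-((1 / (2 * h)) • ((3 : ℝ) • z - (4 : ℝ) • y + x)) + c₀₂ • ((2 : ℝ) • y - x)
      + τ + c₀₂ • σ, z⟫ := by
    rw [← inner_neg_neg] at hmono
    convert hmono using 2
    · rw [hD', hσ, hτ, hx, hy, hz]
      module
    · rw [hz]; abel
  have hstep := bdf2_step_le hh hc hpos
  have hi : 0 ≤ ∫ t in a..(a + 2 * h), ‖Qtt t‖ ^ 2 :=
    intervalIntegral.integral_nonneg (by linarith) fun _ _ => by positivity
  have hi' : 0 ≤ ∫ t in a..(a + 2 * h), ‖Qttt t‖ ^ 2 :=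
    intervalIntegral.integral_nonneg (by linarith) fun _ _ => by positivity
  rw [intervalIntegral.integral_add hi2 hi3]
  set I₂ := ∫ t in a..(a + 2 * h), ‖Qtt t‖ ^ 2
  set I₃ := ∫ t in a..(a + 2 * h), ‖Qttt t‖ ^ 2
  have hsrc : 2 * h * (‖τ‖ ^ 2 + c₀₂ * ‖σ‖ ^ 2) ≤ 144 * (1 + c₀₂) * h ^ 4 * (I₂ + I₃) := by
    have : 2 * h * (‖τ‖ ^ 2 + c₀₂ * ‖σ‖ ^ 2) ≤
        2 * h * (72 * h ^ 3 * I₃ + c₀₂ * (32 * h ^ 3 * I₂)) := by gcongr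
    have p1 : 0 ≤ h ^ 4 * I₂ := by positivity
    have p2 : 0 ≤ h ^ 4 * I₃ := by positivity
    nlinarith [mul_nonneg hc p1, mul_nonneg hc p2]
  have hch : 0 ≤ c₀₂ * h := by positivity
  have hg : 0 ≤ 144 * (1 + c₀₂) * h ^ 4 * (I₂ + I₃) := by positivity
  refine (le_exp_mul_of_implicit_le (a := 2 * h * (1 + 2 * c₀₂)) (b := 2 * h * c₀₂)
    (E₁ := ‖y‖ ^ 2 + ‖(2 : ℝ) • y - x‖ ^ 2) hsmall
    (by positivity) (by linarith) (by linarith) (by positivity) hg ?_).trans_eq (by ring)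
  -- These nonnegative terms complete the partial norms on the right to the full energies at both
  -- levels.
  have q1 : 0 ≤ h * (1 + 2 * c₀₂) * ‖(2 : ℝ) • z - y‖ ^ 2 := by positivity
  have q2 : 0 ≤ h * c₀₂ * ‖y‖ ^ 2 := by positivity
  linarith

/-- The error estimate for the BDF2 discretization of a gradient flow in a Hilbert space, of which
only the monotonicity of the subdifferential is used. -/
theorem bdf2_error_estimate [CompleteSpace X] {c₀₂ T : ℝ} (hc : 0 < c₀₂) (hT : 0 < T)
    {Q Qt Qtt Qttt : ℝ → X} (hQ : IsTimeDeriv T Q Qt) (hQt : IsTimeDeriv T Qt Qtt)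
    (hQtt : IsTimeDeriv T Qtt Qttt) (h2 : MemLp Qtt 2 (volume.restrict (Ioc (0 : ℝ) T)))
    (h3 : MemLp Qttt 2 (volume.restrict (Ioc (0 : ℝ) T))) {δt : ℝ} (hδ : 0 < δt)
    (hsmall : 600 * (1 + c₀₂) * δt < 1) {N : ℕ} (hN : N * δt ≤ T) {Qh : ℕ → X}
    (hQh : ∀ n, 1 ≤ n → n < N → ∃ D : X,
      (∀ᵐ t ∂(volume.restrict (Ioo (0 : ℝ) T)),
        0 ≤ ⟪-Qt t + c₀₂ • Q t - D, Q t - Qh (n + 1)⟫) ∧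
      (1 / (2 * δt)) • ((3 : ℝ) • Qh (n + 1) - (4 : ℝ) • Qh n + Qh (n - 1)) =
        -D + c₀₂ • ((2 : ℝ) • Qh n - Qh (n - 1)))
    {R : ℕ → X} (hR : ∀ n, R n = Qh n - Q (n * δt)) {n : ℕ} (hn1 : 1 ≤ n) (hnN : n ≤ N) :
    ‖R n‖ ^ 2 + ‖(2 : ℝ) • R n - R (n - 1)‖ ^ 2 ≤
      600 * (1 + c₀₂) * Real.exp ((1 - 600 * (1 + c₀₂) * δt)⁻¹ *
        (600 * (1 + c₀₂) * (n * δt))) * (‖R 0‖ ^ 2 + ‖R 1‖ ^ 2 +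
          δt ^ 4 * ∫ t in (0 : ℝ)..(n * δt), (‖Qtt t‖ ^ 2 + ‖Qttt t‖ ^ 2)) := by
  have hT0 : (0 : ℝ) ≤ T := hT.le
  have i2 : IntervalIntegrable (fun t => ‖Qtt t‖ ^ 2) volume 0 T :=
    (intervalIntegrable_iff_integrableOn_Ioc_of_le hT0).2 (h2.integrable_norm_pow two_ne_zero)
  have i3 : IntervalIntegrable (fun t => ‖Qttt t‖ ^ 2) volume 0 T :=
    (intervalIntegrable_iff_integrableOn_Ioc_of_le hT0).2 (h3.integrable_norm_pow two_ne_zero)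
  have hmem : ∀ k : ℕ, k ≤ N → (k : ℝ) * δt ∈ Icc 0 T := fun k hk =>
    ⟨by positivity, le_trans (by gcongr) hN⟩
  have hsub : ∀ {j k : ℕ}, j ≤ N → k ≤ N → uIcc ((j : ℝ) * δt) (k * δt) ⊆ uIcc 0 T := by
    intro j k hj hk
    rw [uIcc_of_le hT0]
    exact uIcc_subset_Icc (hmem j hj) (hmem k hk)
  have i23 : ∀ {j k : ℕ}, j ≤ N → k ≤ N → IntervalIntegrable
      (fun t => ‖Qtt t‖ ^ 2 + ‖Qttt t‖ ^ 2) volume (j * δt) (k * δt) :=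
    fun hj hk => (i2.add i3).mono_set (hsub hj hk)
  set I : ℕ → ℝ := fun k => ∫ t in (0 : ℝ)..(k * δt), (‖Qtt t‖ ^ 2 + ‖Qttt t‖ ^ 2) with hI
  have hIsub : ∀ {j k : ℕ}, j ≤ N → k ≤ N →
      I k - I j = ∫ t in (j * δt)..(k * δt), (‖Qtt t‖ ^ 2 + ‖Qttt t‖ ^ 2) := by
    intro j k hj hk
    refine intervalIntegral.integral_interval_sub_left ?_ ?_
    · simpa using i23 (Nat.zero_le N) hk
    · simpa using i23 (Nat.zero_le N) hj
  have hIle : ∀ {j k : ℕ}, j ≤ k → k ≤ N → I j ≤ I k := by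
    intro j k hjk hk
    rw [← sub_nonneg, hIsub (hjk.trans hk) hk]
    exact intervalIntegral.integral_nonneg (by gcongr) fun _ _ => by positivity
  have hI0 : I 0 = 0 := by simp [hI]
  obtain ⟨m, rfl⟩ : ∃ m, n = m + 1 := ⟨n - 1, by omega⟩
  set θ := (1 - 600 * (1 + c₀₂) * δt)⁻¹ * (600 * (1 + c₀₂) * δt) with hθ
  have hθ0 : 0 ≤ θ := mul_nonneg (inv_nonneg.2 (by linarith)) (by positivity)
  have hstep : ∀ k, k + 1 < N →
      ‖R (k + 2)‖ ^ 2 + ‖(2 : ℝ) • R (k + 2) - R (k + 1)‖ ^ 2 ≤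
        Real.exp θ * (‖R (k + 1)‖ ^ 2 + ‖(2 : ℝ) • R (k + 1) - R k‖ ^ 2) +
          288 * (1 + c₀₂) * δt ^ 4 * (I (k + 2) - I k) := by
    intro k hk
    have e2 : ((k + 2 : ℕ) : ℝ) * δt = k * δt + 2 * δt := by push_cast; ring
    have e1 : ((k + 1 : ℕ) : ℝ) * δt = k * δt + δt := by push_cast; ring
    have s := hsub (j := k) (k := k + 2) (by omega) (by omega)
    rw [hIsub (by omega) (by omega)]
    rw [e2] at s ⊢
    have ht : k * δt + 2 * δt ∈ Icc 0 T := e2 ▸ hmem (k + 2) (by omega)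
    obtain ⟨D, hD, hDeq⟩ := hQh (k + 1) (by omega) hk
    exact bdf2_error_step hc.le hQ hQt hQtt (hmem k (by omega)).1 hδ ht.2
      (i2.mono_set s) (i3.mono_set s) (inner_nonneg_of_ae hT hQ hQt hD ht) hDeq (hR k) (e1 ▸ hR (k + 1)) (e2 ▸ hR (k + 2)) hsmall
  have hgr := discrete_gronwall
    (E := fun k => ‖R k‖ ^ 2 + ‖(2 : ℝ) • R k - R (k - 1)‖ ^ 2) (I := I)
    (m := 288 * (1 + c₀₂) * δt ^ 4) hθ0 (by positivity) hI0
    (fun k hk => hIle (Nat.le_succ k) hk) hstep m hnN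
  refine hgr.trans ?_
  -- From `(2p + q)² ≤ 8p² + 2q²`.
  have hE1 : ‖R 1‖ ^ 2 + ‖(2 : ℝ) • R 1 - R 0‖ ^ 2 ≤ 9 * (‖R 0‖ ^ 2 + ‖R 1‖ ^ 2) := by
    have h1 : ‖(2 : ℝ) • R 1 - R 0‖ ≤ 2 * ‖R 1‖ + ‖R 0‖ := by
      simpa [norm_smul] using _root_.norm_sub_le ((2 : ℝ) • R 1) (R 0)
    have h2 := pow_le_pow_left₀ (norm_nonneg _) h1 2
    nlinarith [sq_nonneg (2 * ‖R 1‖ - ‖R 0‖), sq_nonneg ‖R 0‖]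
  have hIm : I m ≤ I (m + 1) := hIle (Nat.le_succ m) hnN
  have hI1 : 0 ≤ I (m + 1) := hI0 ▸ hIle (Nat.zero_le _) hnN
  -- Only `m` steps follow the starting values; the stated exponent allows `m + 1`.
  have hexp : Real.exp (m * θ) ≤ Real.exp
      ((1 - 600 * (1 + c₀₂) * δt)⁻¹ * (600 * (1 + c₀₂) * ((m + 1 : ℕ) * δt))) := by
    refine Real.exp_le_exp.2 ?_
    have : (1 - 600 * (1 + c₀₂) * δt)⁻¹ * (600 * (1 + c₀₂) * ((m + 1 : ℕ) * δt)) = m * θ + θ := by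
      rw [hθ]; push_cast; ring
    linarith
  have hr : 0 ≤ ‖R 0‖ ^ 2 + ‖R 1‖ ^ 2 := by positivity
  calc _ ≤ Real.exp ((1 - 600 * (1 + c₀₂) * δt)⁻¹ * (600 * (1 + c₀₂) * ((m + 1 : ℕ) * δt))) *
        (600 * (1 + c₀₂) * (‖R 0‖ ^ 2 + ‖R 1‖ ^ 2 + δt ^ 4 * I (m + 1))) := by
        refine mul_le_mul hexp ?_ ?_ (Real.exp_pos _).le
        · have p1 : 0 ≤ c₀₂ * (‖R 0‖ ^ 2 + ‖R 1‖ ^ 2) := by positivity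
          have p2 : 288 * (1 + c₀₂) * δt ^ 4 * (I (m + 1) + I m) ≤
              288 * (1 + c₀₂) * δt ^ 4 * (I (m + 1) + I (m + 1)) := by gcongr
          have p3 : 0 ≤ (1 + c₀₂) * δt ^ 4 * I (m + 1) := by positivity
          linarith
        · have : 0 ≤ I m := hI0 ▸ hIle (Nat.zero_le _) (by omega)
          positivity
    _ = _ := by ring

end Flow

end QTensor

theorem theorem3p4 :
    ∃ K : ℝ, 0 < K ∧
      ∀ (d : ℕ) (_ : 2 ≤ d) (hd : d ≤ 3) (Ω : Set (QTensor.Sp d))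
        (_ : IsOpen Ω) (_ : Bornology.IsBounded Ω)
        (c₀₂ c₂₁ c₂₂ : ℝ) (_ : 0 < c₀₂) (_ : 0 < c₂₁) (_ : 0 < c₂₁ + c₂₂)
        (Qbnd : QTensor.L2Q Ω) (_ : QTensor.MemH1 Qbnd)
        -- the solution of the gradient flow and its first three time derivatives
        (T : ℝ) (_ : 0 < T) (Q Qt Qtt Qttt : ℝ → QTensor.L2Q Ω)
        (_ : QTensor.IsGradientFlow hd c₀₂ c₂₁ c₂₂ Qbnd T Q Qt)
        (_ : QTensor.IsTimeDeriv T Qt Qtt) (_ : QTensor.IsTimeDeriv T Qtt Qttt)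
        (_ : MemLp Qtt 2 (volume.restrict (Ioc (0 : ℝ) T)))
        (_ : MemLp Qttt 2 (volume.restrict (Ioc (0 : ℝ) T)))
        -- the iterates `Qh 0, …, Qh N` of the scheme, with time step `δt` and `t^n = n δt`
        (δt : ℝ) (_ : 0 < δt) (_ : K * (1 + c₀₂) * δt < 1) (N : ℕ) (_ : N * δt ≤ T)
        (Qh : ℕ → QTensor.L2Q Ω)
        (_ : ∀ n, 1 ≤ n → n < N →
          QTensor.IsBDF2Step hd c₀₂ c₂₁ c₂₂ Qbnd δt (Qh (n - 1)) (Qh n) (Qh (n + 1)))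
        (R : ℕ → QTensor.L2Q Ω) (_ : ∀ n, R n = Qh n - Q (n * δt))
        (C : ℝ) (_ : C = K * (1 + c₀₂)),
        ∀ n, 1 ≤ n → n ≤ N →
          ‖R n‖ ^ 2 + ‖(2 : ℝ) • R n - R (n - 1)‖ ^ 2 ≤
            C * Real.exp ((1 - C * δt)⁻¹ * (C * (n * δt))) *
              (‖R 0‖ ^ 2 + ‖R 1‖ ^ 2 +
                δt ^ 4 * ∫ t in (0 : ℝ)..(n * δt), (‖Qtt t‖ ^ 2 + ‖Qttt t‖ ^ 2)) := by
  -- The binding requirement on the constant is `2 * 288 = 576`, from bounding `I (m + 1) + I m` by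
  -- `2 * I (m + 1)`.
  refine ⟨600, by norm_num, ?_⟩
  intro d _ hd Ω _ _ c₀₂ c₂₁ c₂₂ hc _ _ Qbnd _ T hT Q Qt Qtt Qttt hQ hQt hQtt h2 h3 δt hδ hsmall
    N hN Qh hQh R hR C hC n hn1 hnN
  -- Membership in `subdiff` includes finite energy, so each field is an admissible competitor for
  -- the other.
  have hmono : ∀ {A B ψ χ : QTensor.L2Q Ω}, ψ ∈ QTensor.subdiff hd c₂₁ c₂₂ Qbnd A →
      χ ∈ QTensor.subdiff hd c₂₁ c₂₂ Qbnd B → 0 ≤ inner ℝ (ψ - χ) (A - B) := fun hA hB =>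
    QTensor.subgradient_monotone (X := QTensor.L2Q Ω) (f := QTensor.convexEnergy hd c₂₁ c₂₂)
      (hA.2 _ hB.1) (hB.2 _ hA.1)
  have hscheme : ∀ k, 1 ≤ k → k < N → ∃ D : QTensor.L2Q Ω,
      (∀ᵐ t ∂(volume.restrict (Ioo (0 : ℝ) T)),
        0 ≤ inner ℝ (-Qt t + c₀₂ • Q t - D) (Q t - Qh (k + 1))) ∧
      (1 / (2 * δt)) • ((3 : ℝ) • Qh (k + 1) - (4 : ℝ) • Qh k + Qh (k - 1)) =
        -D + c₀₂ • ((2 : ℝ) • Qh k - Qh (k - 1)) := by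
    intro k hk1 hkN
    obtain ⟨D, hD, hDeq⟩ := hQh k hk1 hkN
    exact ⟨D, hQ.2.mono fun t ht => hmono ht hD, hDeq⟩
  subst hC
  have key := @QTensor.bdf2_error_estimate (QTensor.L2Q Ω) _ _ _ c₀₂ T hc hT Q Qt Qtt Qttt
  exact key hQ.1 hQt hQtt h2 h3 hδ hsmall hN hscheme hR hn1 hnN
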